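/- Let $\Omega\subset\mathbb{R}^3$ be a smooth, strictly convex, bounded domain, i.e. $\Omega$ is non-empty, connected and bounded, and there is a smooth function $\xi:\mathbb{R}^3\to\mathbb{R}$ with $\Omega=\{x:\xi(x)<0\}$ and, for some $c>0$, $\sum_{i,j}\partial_i\partial_j\xi(x)\zeta_i\zeta_j\ge c|\zeta|^2$ for all $x\in\bar\Omega$ and $\zeta\in\mathbb{R}^3$. Let $n(x)$ be the outward unit normal at $x\in\partial\Omega$. For $x\in\bar\Omega$ and $v\in\mathbb{R}^3$ put $$t_{\mathbf b}(x,v)=\sup\{s\ge 0:\ x-\tau v\in\Omega\ \text{ for all }\tau\in(0,s)\}\in[0,\infty],\qquad x_{\mathbf b}(x,v)=x-t_{\mathbf b}(x,v)\,v .$$ The stochastic cycles are given by $t_1=t-t_{\mathbf b}(x,v)$, $x_1=x_{\mathbf b}(x,v)$ and, for $j\ge 1$, $t_{j+1}=t_j-t_{\mathbf b}(x_j,v_j)$, $x_{j+1}=x_{\mathbf b}(x_j,v_j)$, where $v_j$ ranges over $\mathcal V_j=\{v_j\in\mathbb{R}^3: n(x_j)\cdot v_j>0\}$; thus $t_k$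 is a function of $(t,x,v,v_1,\dots,v_{k-1})$. (If $x\in\Omega$ and $v=0$, then $t_{\mathbf b}(x,v)=\infty$, all $t_k$ are $-\infty$, and the integral below is $0$.) On $\mathcal V_j$ consider the diffuse reflection measure $d\sigma_j=\sqrt{2\pi}\,\mu(v_j)\,\{n(x_j)\cdot v_j\}\,dv_j$ with $\mu(v)=(2\pi)^{-3/2}e^{-|v|^2/2}$. Then there are constants $\mathfrak C>0$ and $A>0$, depending only on $\Omega$, such that for all real $t\ge 0$ and all integers $k\ge 1$ with $k\ge\mathfrak C t$, $$\sup_{(x,v)\in\bar\Omega\times\mathbb{R}^3}\ \int_{\mathcal V_1}\cdots\int_{\mathcal V_{k-1}}\mathbf 1_{\{t_k(t,x,v,v_1,\dots,v_{k-1})\ge 0\}}\,d\sigma_{k-1}\cdots d\sigma_1\ \le\ A\,e^{-t}.$$ -/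

import Mathlib

open MeasureTheory Set Filter Topology
open scoped ENNReal ContDiff RealInnerProductSpace

noncomputable section

namespace DiffuseCycles

/-- Three-dimensional Euclidean space, used both for positions and for velocities. -/
abbrev E3 : Type := EuclideanSpace ℝ (Fin 3)

/-- A smooth, strictly convex, bounded domain of `ℝ³`: a bounded, connected, non-empty set of the
form `{ξ < 0}`, where `ξ : ℝ³ → ℝ` is smooth (`C^∞`) and its Hessian is uniformly positive definite
on the closure of the domain. -/
def IsSmoothStrictlyConvexDomain (Ω : Set E3) : Prop :=
  IsConnected Ω ∧ Bornology.IsBounded Ω ∧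
    ∃ ξ : E3 → ℝ, ContDiff ℝ ∞ ξ ∧ Ω = {x | ξ x < 0} ∧
      ∃ c : ℝ, 0 < c ∧ ∀ x ∈ closure Ω, ∀ ζ : E3, c * ‖ζ‖ ^ 2 ≤ fderiv ℝ (fderiv ℝ ξ) x ζ ζ

/-- `ν` is the outward unit normal of `Ω` at `x`: a unit vector such that every ray from `x` in a
direction `w` with `ν · w < 0` starts out inside `Ω`, and every ray with `ν · w > 0` starts out
outside `Ω`. -/
def IsOutwardUnitNormal (Ω : Set E3) (x ν : E3) : Prop :=
  ‖ν‖ = 1 ∧ ∀ w : E3,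
    (⟪ν, w⟫ < 0 → ∀ᶠ s : ℝ in 𝓝[>] 0, x + s • w ∈ Ω) ∧
    (0 < ⟪ν, w⟫ → ∀ᶠ s : ℝ in 𝓝[>] 0, x + s • w ∉ Ω)

theorem IsOutwardUnitNormal.unique {Ω : Set E3} {x ν ν' : E3}
    (h : IsOutwardUnitNormal Ω x ν) (h' : IsOutwardUnitNormal Ω x ν') : ν = ν' := by
  by_contra hne
  have hlt : ⟪ν, ν'⟫ < 1 := (inner_lt_one_iff_real_of_norm_eq_one h.1 h'.1).2 hne
  have e1 : ⟪ν, ν' - ν⟫ < 0 := by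
    rw [inner_sub_right, real_inner_self_eq_norm_sq, h.1]; linarith
  have e2 : 0 < ⟪ν', ν' - ν⟫ := by
    rw [inner_sub_right, real_inner_self_eq_norm_sq, h'.1, real_inner_comm]; linarith
  obtain ⟨s, hs, hs'⟩ := (((h.2 _).1 e1).and ((h'.2 _).2 e2)).exists
  exact hs' hs

open Classical in
/-- The outward unit normal `n(x)` at `x ∈ ∂Ω` (and `0` where there is none). -/
def outwardNormal (Ω : Set E3) (x : E3) : E3 :=
  if h : ∃ ν, IsOutwardUnitNormal Ω x ν then h.choose else 0

theorem IsOutwardUnitNormal.outwardNormal_eq {Ω : Set E3} {x ν : E3}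
    (h : IsOutwardUnitNormal Ω x ν) : outwardNormal Ω x = ν := by
  have hex : ∃ ν, IsOutwardUnitNormal Ω x ν := ⟨ν, h⟩
  rw [outwardNormal, dif_pos hex]
  exact hex.choose_spec.unique h

/-- The backward exit time `t_b(x, v) = sup {s ≥ 0 : x - τ v ∈ Ω for all τ ∈ (0, s)}`. It takes the
value `+∞` exactly when the backward trajectory never leaves `Ω`; for a bounded `Ω` this happens
only for `x ∈ Ω`, `v = 0`. -/
def backwardExitTime (Ω : Set E3) (x v : E3) : EReal :=
  ⨆ s ∈ {s : ℝ | 0 ≤ s ∧ ∀ τ : ℝ, 0 < τ → τ < s → x - τ • v ∈ Ω}, (s : EReal)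

/-- The backward exit position `x_b(x, v) = x - t_b(x, v) v` (read as `x` when `t_b = ∞`). -/
def backwardExitPosition (Ω : Set E3) (x v : E3) : E3 :=
  x - (backwardExitTime Ω x v).toReal • v

/-- The stochastic cycle: `cycle Ω t x v m (v₁, …, v_m) = (t_{m+1}, x_{m+1})`, where
`t₁ = t - t_b(x, v)`, `x₁ = x_b(x, v)` and `t_{j+1} = t_j - t_b(x_j, v_j)`,
`x_{j+1} = x_b(x_j, v_j)`. -/
def cycle (Ω : Set E3) (t : ℝ) (x v : E3) : (m : ℕ) → (Fin m → E3) → EReal × E3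
  | 0, _ => ((t : EReal) - backwardExitTime Ω x v, backwardExitPosition Ω x v)
  | m + 1, u =>
      let p := cycle Ω t x v m (Fin.init u)
      (p.1 - backwardExitTime Ω p.2 (u (Fin.last m)), backwardExitPosition Ω p.2 (u (Fin.last m)))

/-- The global Maxwellian `μ(v) = (2π)^{-3/2} exp(-|v|²/2)`. -/
def maxwellian (v : E3) : ℝ := (2 * Real.pi) ^ (-(3 / 2 : ℝ)) * Real.exp (-‖v‖ ^ 2 / 2)

/-- The diffuse reflection measure `dσ = √(2π) μ(w) (n(x) · w) dw` on
`{w ∈ ℝ³ : n(x) · w > 0}`. -/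
def reflectionMeasure (Ω : Set E3) (x : E3) : Measure E3 :=
  (volume.restrict {w : E3 | 0 < ⟪outwardNormal Ω x, w⟫}).withDensity fun w =>
    ENNReal.ofReal (Real.sqrt (2 * Real.pi) * maxwellian w * ⟪outwardNormal Ω x, w⟫)

/-- The iterated integral `∫_{V₁} ⋯ ∫_{V_m} G(v₁, …, v_m) dσ_m ⋯ dσ₁`, in which `dσ_j` is the diffuse
reflection measure at the cycle position `x_j = x_j(x, v, v₁, …, v_{j-1})`. -/
def cycleIntegral (Ω : Set E3) (t : ℝ) (x v : E3) : (m : ℕ) → ((Fin m → E3) → ℝ≥0∞) → ℝ≥0∞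
  | 0, G => G Fin.elim0
  | m + 1, G =>
      cycleIntegral Ω t x v m fun u =>
        ∫⁻ w, G (Fin.snoc u w) ∂(reflectionMeasure Ω (cycle Ω t x v m u).2)

end DiffuseCycles

end

/-! This is an exponential Chebyshev bound. Since `1_{t_k ≥ 0} ≤ exp t_k` and `t_k` is `t` minus the
successive exit times, it suffices that integrating `exp (-t_b)` against the reflection measure
gives at most some `q < 1` at every boundary point. Integrating out the velocities from the last one
backwards (`cycleIntegral_exp_le`) then yields `q ^ (k - 1) * exp t`, which is `O(exp (-t))` once
`k` exceeds a suitable multiple of `t`.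

The uniform `q` has two sources. Near the boundary, the linear term of `ξ` dominates its quadratic
Taylor remainder, so `t_b(x, w) ≥ c (ν · w) / |w|²` with `c` independent of `x`
(`exists_boundary_bound`). The Laplace transform of this lower bound does not depend on `ν`, by
rotation invariance, and it is below one because the reflection measure is a probability measure
(`exists_lintegral_exp_neg_le`). -/

namespace DiffuseCycles

/-! ### The half-space Maxwellian: rotation invariance, total mass, Laplace transform. -/

/-- The diffuse reflection measure attached to a direction `ν`. -/
noncomputable def halfMaxwellian (ν : E3) : Measure E3 :=
  (volume.restrict {w : E3 | 0 < ⟪ν, w⟫}).withDensity fun w =>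
    ENNReal.ofReal (Real.sqrt (2 * Real.pi) * maxwellian w * ⟪ν, w⟫)

theorem IsOutwardUnitNormal.reflectionMeasure_eq {Ω : Set E3} {x ν : E3}
    (h : IsOutwardUnitNormal Ω x ν) : reflectionMeasure Ω x = halfMaxwellian ν := by
  rw [reflectionMeasure, h.outwardNormal_eq, halfMaxwellian]

theorem measurable_maxwellian : Measurable maxwellian := by
  unfold maxwellian
  fun_prop

theorem measurableSet_inner_pos (ν : E3) : MeasurableSet {w : E3 | 0 < ⟪ν, w⟫} :=
  measurableSet_lt measurable_const (by fun_prop)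

/-- The density is measurable and finite, so `F` may be arbitrary; measurability of integrands is
never needed. -/
theorem lintegral_halfMaxwellian (ν : E3) (F : E3 → ℝ≥0∞) :
    ∫⁻ w, F w ∂halfMaxwellian ν = ∫⁻ w, {w : E3 | 0 < ⟪ν, w⟫}.indicator (fun w =>
      ENNReal.ofReal (Real.sqrt (2 * Real.pi) * maxwellian w * ⟪ν, w⟫) * F w) w := by
  have hm : Measurable fun w : E3 =>
      ENNReal.ofReal (Real.sqrt (2 * Real.pi) * maxwellian w * ⟪ν, w⟫) := by
    have := measurable_maxwellian
    fun_prop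
  rw [halfMaxwellian, lintegral_withDensity_eq_lintegral_mul_non_measurable _ hm
    (ae_of_all _ fun _ => ENNReal.ofReal_lt_top), lintegral_indicator (measurableSet_inner_pos ν)]
  rfl

theorem ae_halfMaxwellian_inner_pos (ν : E3) : ∀ᵐ w ∂halfMaxwellian ν, 0 < ⟪ν, w⟫ :=
  (withDensity_absolutelyContinuous _ _).ae_le (ae_restrict_mem (measurableSet_inner_pos ν))

/-- Integrals of functions of `(ν · w, |w|)` against the half-space Maxwellian do not depend on the
unit vector `ν`. -/
theorem lintegral_halfMaxwellian_rotate {ν ν' : E3} (h : ‖ν‖ = ‖ν'‖) (F : ℝ → ℝ → ℝ≥0∞) :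
    ∫⁻ w, F ⟪ν, w⟫ ‖w‖ ∂halfMaxwellian ν = ∫⁻ w, F ⟪ν', w⟫ ‖w‖ ∂halfMaxwellian ν' := by
  -- For vectors of equal length this reflection carries `ν` to `ν'`; it preserves volume and norms,
  -- hence the Maxwellian.
  set R := (ℝ ∙ (ν - ν'))ᗮ.reflection
  have hR : R ν = ν' := Submodule.reflection_sub h
  have hi (w : E3) : ⟪ν', R w⟫ = ⟪ν, w⟫ := by rw [← hR, R.inner_map_map]
  rw [lintegral_halfMaxwellian, lintegral_halfMaxwellian]
  refine Eq.trans (lintegral_congr fun w => ?_)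
    (R.measurePreserving.lintegral_comp_emb R.toHomeomorph.measurableEmbedding _)
  simp [Set.indicator, hi, maxwellian]

theorem integral_Ioi_mul_exp_neg_sq_div_two :
    ∫ s in Ioi (0 : ℝ), s * Real.exp (-s ^ 2 / 2) = 1 := by
  have h := integral_rpow_mul_exp_neg_mul_rpow (p := 2) (q := 1) (b := 1 / 2)
    (by norm_num) (by norm_num) (by norm_num)
  norm_num [Real.rpow_neg_one] at h
  rw [← h]
  refine integral_congr_ae (ae_of_all _ fun s => ?_)
  ring_nf

theorem integrableOn_Ioi_mul_exp_neg_sq_div_two :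
    IntegrableOn (fun s : ℝ => s * Real.exp (-s ^ 2 / 2)) (Ioi 0) := by
  -- A non-integrable function has Bochner integral `0` by convention, whereas this integral is `1`.
  by_contra h
  have := integral_Ioi_mul_exp_neg_sq_div_two
  rw [integral_undef h] at this
  exact zero_ne_one this

theorem integral_exp_neg_sq_div_two :
    ∫ s : ℝ, Real.exp (-s ^ 2 / 2) = Real.sqrt (2 * Real.pi) := by
  have h := integral_gaussian (1 / 2)
  rw [show Real.pi / (1 / 2) = 2 * Real.pi by ring] at h
  rw [← h]
  congr 1; ext s; ring_nf

theorem integrable_exp_neg_sq_div_two : Integrable fun s : ℝ => Real.exp (-s ^ 2 / 2) := by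
  have h := integrable_exp_neg_mul_sq (b := 1 / 2) (by norm_num)
  refine h.congr (ae_of_all _ fun s => ?_)
  ring_nf

/-- One-dimensional factors of the density of `halfMaxwellian (single 0 1)`. -/
noncomputable def halfMaxwellianFactor (i : Fin 3) (s : ℝ) : ℝ :=
  if i = 0 then (Ioi (0 : ℝ)).indicator (fun s => s * Real.exp (-s ^ 2 / 2)) s
  else Real.exp (-s ^ 2 / 2)

theorem integrable_halfMaxwellianFactor (i : Fin 3) : Integrable (halfMaxwellianFactor i) := by
  unfold halfMaxwellianFactor
  split_ifs
  · exact integrableOn_Ioi_mul_exp_neg_sq_div_two.integrable_indicator measurableSet_Ioi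
  · exact integrable_exp_neg_sq_div_two

theorem halfMaxwellianFactor_nonneg (i : Fin 3) (s : ℝ) : 0 ≤ halfMaxwellianFactor i s := by
  unfold halfMaxwellianFactor
  split_ifs
  · exact indicator_nonneg (fun s hs => mul_nonneg (le_of_lt hs) (Real.exp_pos _).le) s
  · positivity

theorem integral_prod_halfMaxwellianFactor :
    ∫ y : Fin 3 → ℝ, ∏ i, halfMaxwellianFactor i (y i) = 2 * Real.pi := by
  rw [integral_fintype_prod_volume_eq_prod, Fin.prod_univ_three]
  simp only [halfMaxwellianFactor, if_true, one_ne_zero, if_false, Fin.reduceEq]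
  rw [integral_indicator measurableSet_Ioi, integral_Ioi_mul_exp_neg_sq_div_two,
    integral_exp_neg_sq_div_two, one_mul, Real.mul_self_sqrt (by positivity)]

theorem sqrt_two_pi_mul_rpow :
    Real.sqrt (2 * Real.pi) * (2 * Real.pi) ^ (-(3 / 2 : ℝ)) = (2 * Real.pi)⁻¹ := by
  rw [Real.sqrt_eq_rpow, ← Real.rpow_add (by positivity), ← Real.rpow_neg_one]
  norm_num

/-- In coordinates the density is `(2π)⁻¹` times a half-line factor of integral `1` and two
Gaussians of integral `√(2π)` each. -/
theorem halfMaxwellian_single_univ :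
    halfMaxwellian (EuclideanSpace.single 0 1) univ = 1 := by
  have key : ∀ w : E3, {w : E3 | 0 < ⟪(EuclideanSpace.single 0 1 : E3), w⟫}.indicator (fun w =>
      ENNReal.ofReal (Real.sqrt (2 * Real.pi) * maxwellian w *
        ⟪(EuclideanSpace.single 0 1 : E3), w⟫) * 1) w =
      ENNReal.ofReal ((2 * Real.pi)⁻¹ * ∏ i, halfMaxwellianFactor i (w i)) := by
    intro w
    have hn : ‖w‖ ^ 2 = w 0 ^ 2 + w 1 ^ 2 + w 2 ^ 2 := by
      rw [EuclideanSpace.norm_sq_eq, Fin.sum_univ_three]; simp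
    by_cases h : 0 < w 0
    · simp only [Fin.prod_univ_three, halfMaxwellianFactor, Set.indicator, mem_ofPred_eq,
        EuclideanSpace.inner_single_left, map_one, one_mul, h, if_true, mem_Ioi, one_ne_zero,
        if_false, Fin.reduceEq, mul_one, maxwellian]
      rw [← sqrt_two_pi_mul_rpow, hn,
        show -(w 0 ^ 2 + w 1 ^ 2 + w 2 ^ 2) / 2 = -w 0 ^ 2 / 2 + -w 1 ^ 2 / 2 + -w 2 ^ 2 / 2 by ring,
        Real.exp_add, Real.exp_add]
      congr 1; ring
    · have h' : ¬ 0 < ⟪(EuclideanSpace.single 0 1 : E3), w⟫ := by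
        rwa [EuclideanSpace.inner_single_left, map_one, one_mul]
      rw [indicator_of_notMem (s := {w : E3 | 0 < ⟪(EuclideanSpace.single 0 1 : E3), w⟫}) h']
      simp [Fin.prod_univ_three, halfMaxwellianFactor, h]
  have hint : Integrable fun y : Fin 3 → ℝ => ∏ i, halfMaxwellianFactor i (y i) :=
    Integrable.fintype_prod integrable_halfMaxwellianFactor
  rw [← lintegral_one, lintegral_halfMaxwellian, lintegral_congr key]
  have hp := (EuclideanSpace.volume_preserving_symm_measurableEquiv_toLp (Fin 3)).lintegral_comp_emb
    (MeasurableEquiv.measurableEmbedding _) fun y : Fin 3 → ℝ =>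
      ENNReal.ofReal ((2 * Real.pi)⁻¹ * ∏ i, halfMaxwellianFactor i (y i))
  refine hp.trans ?_
  rw [← ofReal_integral_eq_lintegral_ofReal (hint.const_mul _) (ae_of_all _ fun y =>
    mul_nonneg (by positivity) (Finset.prod_nonneg fun i _ => halfMaxwellianFactor_nonneg i _)),
    integral_const_mul, integral_prod_halfMaxwellianFactor, inv_mul_cancel₀ (by positivity),
    ENNReal.ofReal_one]

/-- The Laplace transform of `c (ν · w) / |w|²` under the diffuse reflection measure is bounded by a
constant less than one, uniformly in the unit vector `ν`. -/
theorem exists_lintegral_exp_neg_le {c : ℝ} (hc : 0 < c) :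
    ∃ q : ℝ, 0 < q ∧ q < 1 ∧ ∀ ν : E3, ‖ν‖ = 1 →
      ∫⁻ w, ENNReal.ofReal (Real.exp (-(c * ⟪ν, w⟫ / ‖w‖ ^ 2))) ∂halfMaxwellian ν
        ≤ ENNReal.ofReal q := by
  set e : E3 := EuclideanSpace.single 0 1
  set I := ∫⁻ w, ENNReal.ofReal (Real.exp (-(c * ⟪e, w⟫ / ‖w‖ ^ 2))) ∂halfMaxwellian e
  have he : ‖e‖ = 1 := by simp [e]
  have hlt : ∀ᵐ w ∂halfMaxwellian e,
      ENNReal.ofReal (Real.exp (-(c * ⟪e, w⟫ / ‖w‖ ^ 2))) < 1 := by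
    filter_upwards [ae_halfMaxwellian_inner_pos e] with w hw
    have hw0 : w ≠ 0 := by rintro rfl; simp at hw
    rw [ENNReal.ofReal_lt_one, Real.exp_lt_one_iff, neg_lt_zero]
    have := norm_pos_iff.2 hw0
    positivity
  have h1 : ∫⁻ _, 1 ∂halfMaxwellian e = 1 := by
    rw [lintegral_one, halfMaxwellian_single_univ]
  have hI1 : I < 1 := by
    rw [← h1]
    refine lintegral_strict_mono ?_ aemeasurable_const (ne_top_of_le_ne_top ENNReal.one_ne_top ?_) hlt
    · intro h0
      simp [h0] at h1
    · rw [← h1]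
      exact lintegral_mono_ae (hlt.mono fun _ => le_of_lt)
  -- The maximum with `1 / 2` makes `q` positive without a lower bound on `I`, so that `log q` and
  -- `q⁻¹` are usable later.
  refine ⟨max I.toReal (1 / 2), by positivity, max_lt ?_ (by norm_num), fun ν hν => ?_⟩
  · simpa using (ENNReal.toReal_lt_toReal hI1.ne_top ENNReal.one_ne_top).2 hI1
  · rw [lintegral_halfMaxwellian_rotate (hν.trans he.symm)
      fun a r => ENNReal.ofReal (Real.exp (-(c * a / r ^ 2)))]
    exact (ENNReal.ofReal_toReal hI1.ne_top).ge.trans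
      (ENNReal.ofReal_le_ofReal (le_max_left _ _))

/-! ### Boundary geometry: a lower bound for the exit time. -/

/-- A critical point at which the Hessian is positive definite is a local minimum. -/
theorem isLocalMin_of_hessian_pos {f : E3 → ℝ} (hf : ContDiff ℝ 2 f) {x : E3} {c : ℝ} (hc : 0 < c)
    (h0 : fderiv ℝ f x = 0) (h2 : ∀ ζ : E3, c * ‖ζ‖ ^ 2 ≤ fderiv ℝ (fderiv ℝ f) x ζ ζ) :
    IsLocalMin f x := by
  have hd : Differentiable ℝ f := hf.differentiable (by norm_num)
  have hdd : Differentiable ℝ (fderiv ℝ f) :=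
    (hf.fderiv_right (m := 1) (by norm_num)).differentiable (by norm_num)
  -- The error constant is taken equal to `c`, so the Hessian bound absorbs the error and `f` is
  -- nondecreasing along each short segment from `x`.
  have ho := (hdd x).hasFDerivAt.isLittleO.def hc
  obtain ⟨r, hr, hball⟩ := Metric.eventually_nhds_iff_ball.1 ho
  refine Metric.eventually_nhds_iff_ball.2 ⟨r, hr, fun y hy => ?_⟩
  set h := y - x with hh
  have hφ (s : ℝ) : HasDerivAt (fun s : ℝ => f (x + s • h)) (fderiv ℝ f (x + s • h) h) s := by
    have hl : HasDerivAt (fun s : ℝ => x + s • h) h s := by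
      simpa using ((hasDerivAt_id s).smul_const h).const_add x
    exact (hd _).hasFDerivAt.comp_hasDerivAt s hl
  have hmono : MonotoneOn (fun s : ℝ => f (x + s • h)) (Icc 0 1) := by
    refine monotoneOn_of_deriv_nonneg (convex_Icc 0 1)
      (fun s _ => (hφ s).continuousAt.continuousWithinAt)
      (fun s _ => (hφ s).differentiableAt.differentiableWithinAt) fun s hs => ?_
    rw [interior_Icc] at hs
    rw [(hφ s).deriv]
    have hmem : x + s • h ∈ Metric.ball x r := by
      rw [mem_ball_iff_norm, add_sub_cancel_left, norm_smul, Real.norm_of_nonneg hs.1.le]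
      rw [mem_ball_iff_norm] at hy
      nlinarith [norm_nonneg h, hs.2]
    have hb := hball _ hmem
    rw [h0, sub_zero, add_sub_cancel_left] at hb
    have h3 := (ContinuousLinearMap.le_opNorm
      (fderiv ℝ f (x + s • h) - fderiv ℝ (fderiv ℝ f) x (s • h)) h).trans
        (mul_le_mul_of_nonneg_right hb (norm_nonneg h))
    rw [_root_.sub_apply, Real.norm_eq_abs, norm_smul,
      Real.norm_of_nonneg hs.1.le] at h3
    have h4 := mul_le_mul_of_nonneg_left (h2 h) hs.1.le
    have h5 := (abs_le.1 h3).1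
    simp only [map_smul, _root_.smul_apply, smul_eq_mul] at h5
    nlinarith
  have := hmono (left_mem_Icc.2 zero_le_one) (right_mem_Icc.2 zero_le_one) zero_le_one
  simpa [hh] using this

/-- First-order Taylor expansion with a remainder that is uniform for base points in a ball. -/
theorem exists_taylor_bound {f : E3 → ℝ} (hf : ContDiff ℝ 2 f) (R : ℝ) :
    ∃ M : ℝ, 0 < M ∧ ∀ x ∈ Metric.closedBall (0 : E3) R, ∀ h : E3, ‖h‖ ≤ 1 →
      |f (x + h) - f x - fderiv ℝ f x h| ≤ M * ‖h‖ ^ 2 := by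
  have hd : Differentiable ℝ f := hf.differentiable (by norm_num)
  have hf1 : ContDiff ℝ 1 (fderiv ℝ f) := hf.fderiv_right (by norm_num)
  have hdd : Differentiable ℝ (fderiv ℝ f) := hf1.differentiable (by norm_num)
  have hcont : Continuous (fderiv ℝ (fderiv ℝ f)) := hf1.continuous_fderiv (by norm_num)
  -- The radius `R + 1` contains every `x + h` with `‖h‖ ≤ 1`.
  obtain ⟨M, hM⟩ : ∃ M, ∀ y ∈ Metric.closedBall (0 : E3) (R + 1),
      ‖fderiv ℝ (fderiv ℝ f) y‖ ≤ M := by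
    obtain ⟨M, hM⟩ := (isCompact_closedBall (0 : E3) (R + 1)).bddAbove_image
      (Continuous.norm (E := E3 →L[ℝ] E3 →L[ℝ] ℝ) hcont).continuousOn
    exact ⟨M, fun y hy => hM (mem_image_of_mem _ hy)⟩
  refine ⟨max M 1, by positivity, fun x hx h hh => ?_⟩
  have hM0 : 0 ≤ max M 1 := by positivity
  have hsub : Metric.closedBall x ‖h‖ ⊆ Metric.closedBall 0 (R + 1) :=
    Metric.closedBall_subset_closedBall' (by
      have := Metric.mem_closedBall.1 hx
      linarith)
  have hlip : ∀ y ∈ Metric.closedBall x ‖h‖, ‖fderiv ℝ f y - fderiv ℝ f x‖ ≤ max M 1 * ‖h‖ := by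
    intro y hy
    refine ((convex_closedBall x ‖h‖).norm_image_sub_le_of_norm_hasFDerivWithin_le
      (fun z _ => (hdd z).hasFDerivAt.hasFDerivWithinAt)
      (fun z hz => (hM z (hsub hz)).trans (le_max_left M 1))
      (Metric.mem_closedBall_self (norm_nonneg h)) hy).trans ?_
    exact mul_le_mul_of_nonneg_left (mem_closedBall_iff_norm.1 hy) hM0
  have := (convex_closedBall x ‖h‖).norm_image_sub_le_of_norm_hasFDerivWithin_le'
    (y := x + h) (fun z _ => (hd z).hasFDerivAt.hasFDerivWithinAt) hlip
    (Metric.mem_closedBall_self (norm_nonneg h)) (by simp)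
  rw [add_sub_cancel_left, Real.norm_eq_abs] at this
  linarith [this, sq ‖h‖, mul_assoc (max M 1) ‖h‖ ‖h‖, congrArg (max M 1 * ·) (sq ‖h‖)]

/-- A lower bound for the backward exit time at the boundary. -/
theorem exists_boundary_bound {Ω : Set E3} (hΩ : IsSmoothStrictlyConvexDomain Ω) :
    ∃ c : ℝ, 0 < c ∧ ∀ x ∈ frontier Ω, ∃ ν : E3, IsOutwardUnitNormal Ω x ν ∧
      ∀ w : E3, 0 < ⟪ν, w⟫ → ((c * ⟪ν, w⟫ / ‖w‖ ^ 2 : ℝ) : EReal) ≤ backwardExitTime Ω x w := by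
  obtain ⟨-, hb, ξ, hξ', hset, k, hk, hH⟩ := hΩ
  have hξ : ContDiff ℝ 2 ξ := hξ'.of_le (WithTop.coe_le_coe.2 le_top)
  have hcd : Continuous (fderiv ℝ ξ) := hξ.continuous_fderiv (by norm_num)
  have hmem (y : E3) : y ∈ Ω ↔ ξ y < 0 := by rw [hset]; rfl
  have hop : IsOpen Ω := by rw [hset]; exact isOpen_lt hξ.continuous continuous_const
  have hcl : ∀ x ∈ closure Ω, ξ x ≤ 0 := by
    intro x hx
    refine closure_minimal (t := {y | ξ y ≤ 0}) (fun y hy => ((hmem y).1 hy).le)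
      (isClosed_le hξ.continuous continuous_const) hx
  have hzero : ∀ x ∈ frontier Ω, ξ x = 0 := by
    intro x hx
    rw [hop.frontier_eq] at hx
    exact le_antisymm (hcl x hx.1) (not_lt.1 fun h => hx.2 ((hmem x).2 h))
  have hne : ∀ x ∈ frontier Ω, fderiv ℝ ξ x ≠ 0 := by
    intro x hx h0
    -- Convexity enters only here: a critical boundary point would be a local minimum with value
    -- `0`, yet points with `ξ < 0` accumulate there.
    have hmin := isLocalMin_of_hessian_pos hξ hk h0 (hH x (frontier_subset_closure hx))
    obtain ⟨y, hy, hy'⟩ := ((mem_closure_iff_frequently.1 (frontier_subset_closure hx)).and_eventually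
      hmin).exists
    rw [hzero x hx] at hy'
    exact absurd ((hmem y).1 hy) (not_lt.2 hy')
  have hcomp : IsCompact (frontier Ω) :=
    Metric.isCompact_of_isClosed_isBounded isClosed_frontier (hb.closure.subset frontier_subset_closure)
  obtain ⟨m, hm, hmle⟩ : ∃ m : ℝ, 0 < m ∧ ∀ x ∈ frontier Ω, m ≤ ‖fderiv ℝ ξ x‖ := by
    rcases (frontier Ω).eq_empty_or_nonempty with he | hne'
    · exact ⟨1, one_pos, by simp [he]⟩
    · obtain ⟨x, hx, hmin⟩ := hcomp.exists_isMinOn hne' hcd.norm.continuousOn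
      exact ⟨_, norm_pos_iff.2 (hne x hx), fun y hy => hmin hy⟩
  obtain ⟨R, hR⟩ := hcomp.isBounded.subset_closedBall (0 : E3)
  obtain ⟨M, hM, htay⟩ := exists_taylor_bound hξ R
  -- The bound `1` keeps `τ‖w‖ ≤ 1`, as the Taylor estimate requires; `m / M` makes the remainder `M
  -- τ²‖w‖²` smaller than the linear gain `τ‖D‖(ν · w)`.
  refine ⟨min 1 (m / M), by positivity, fun x hx => ?_⟩
  set D := fderiv ℝ ξ x with hD
  set g : E3 := (InnerProductSpace.toDual ℝ E3).symm D with hg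
  have hgD (w : E3) : ⟪g, w⟫ = D w := InnerProductSpace.toDual_symm_apply
  have hgn : ‖g‖ = ‖D‖ := LinearIsometryEquiv.norm_map _ _
  have hD0 : 0 < ‖D‖ := norm_pos_iff.2 (hne x hx)
  set ν : E3 := ‖D‖⁻¹ • g with hν
  have hνn : ‖ν‖ = 1 := by
    rw [hν, norm_smul, hgn, norm_inv, norm_norm, inv_mul_cancel₀ hD0.ne']
  have hνD (w : E3) : D w = ‖D‖ * ⟪ν, w⟫ := by
    rw [hν, real_inner_smul_left, hgD, mul_inv_cancel_left₀ hD0.ne']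
  have hder (w : E3) : HasDerivAt (fun s : ℝ => ξ (x + s • w)) (D w) 0 := by
    have hl : HasDerivAt (fun s : ℝ => x + s • w) w 0 := by
      simpa using ((hasDerivAt_id (0 : ℝ)).smul_const w).const_add x
    have hx0 : HasFDerivAt ξ D (x + (0 : ℝ) • w) := by
      simpa using (hξ.differentiable (by norm_num) x).hasFDerivAt
    exact hx0.comp_hasDerivAt 0 hl
  have hslope (w : E3) : Tendsto (fun s : ℝ => s⁻¹ * ξ (x + s • w)) (𝓝[>] 0) (𝓝 (D w)) := by
    have := (hasDerivAt_iff_tendsto_slope_zero.1 (hder w)).mono_left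
      (nhdsWithin_mono (s := Ioi 0) 0 fun s hs => ne_of_gt hs)
    simpa [hzero x hx] using this
  refine ⟨ν, ⟨hνn, fun w => ⟨fun hw => ?_, fun hw => ?_⟩⟩, fun w hw => ?_⟩
  · have hneg : D w < 0 := by rw [hνD]; exact mul_neg_of_pos_of_neg hD0 hw
    filter_upwards [(hslope w).eventually_lt_const hneg, self_mem_nhdsWithin] with s hs hs0
    rw [hmem]
    have hs0' : 0 < s⁻¹ := inv_pos.2 hs0
    exact (pos_iff_neg_of_mul_neg hs).1 hs0'
  · have hpos : 0 < D w := by rw [hνD]; positivity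
    filter_upwards [(hslope w).eventually_const_lt hpos, self_mem_nhdsWithin] with s hs hs0
    rw [hmem, not_lt]
    have hs0' : 0 < s⁻¹ := inv_pos.2 hs0
    exact ((pos_iff_pos_of_mul_pos hs).1 hs0').le
  · have hw0 : 0 < ‖w‖ := norm_pos_iff.2 (by rintro rfl; simp at hw)
    have hcs : ⟪ν, w⟫ ≤ ‖w‖ := by simpa [hνn] using real_inner_le_norm ν w
    refine le_iSup₂_of_le (min 1 (m / M) * ⟪ν, w⟫ / ‖w‖ ^ 2) ⟨by positivity, fun τ hτ hτ' => ?_⟩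
      le_rfl
    rw [lt_div_iff₀ (by positivity)] at hτ'
    have h1 : τ * ‖w‖ ^ 2 < ⟪ν, w⟫ :=
      hτ'.trans_le (mul_le_of_le_one_left hw.le (min_le_left _ _))
    have h2 : M * (τ * ‖w‖ ^ 2) < m * ⟪ν, w⟫ := by
      have := hτ'.trans_le (mul_le_mul_of_nonneg_right (min_le_right _ _) hw.le)
      rw [div_mul_eq_mul_div, lt_div_iff₀ hM] at this
      linarith
    have h3 : ‖-(τ • w)‖ ≤ 1 := by
      rw [norm_neg, norm_smul, Real.norm_of_nonneg hτ.le]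
      by_contra! h
      nlinarith
    have h4 := (abs_le.1 (htay x (hR hx) _ h3)).2
    rw [hzero x hx, norm_neg, norm_smul, Real.norm_of_nonneg hτ.le, ← hD, map_neg, map_smul,
      smul_eq_mul, hνD] at h4
    rw [hmem, sub_eq_add_neg]
    have h5 := mul_le_mul_of_nonneg_right (hmle x hx) hw.le
    have h6 : τ * (M * (τ * ‖w‖ ^ 2)) < τ * (‖D‖ * ⟪ν, w⟫) :=
      mul_lt_mul_of_pos_left (h2.trans_le h5) hτ
    nlinarith

/-! ### Cycles and the exponential moment of the cycle time. -/

theorem backwardExitTime_nonneg (Ω : Set E3) (x v : E3) : 0 ≤ backwardExitTime Ω x v :=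
  le_iSup₂_of_le (0 : ℝ) ⟨le_rfl, fun _ h h' => absurd (h.trans h') (lt_irrefl _)⟩ le_rfl

/-- A backward trajectory issued from the closure of an open set stays inside or exits through the
boundary. -/
theorem backwardExitPosition_mem_frontier {Ω : Set E3} (hop : IsOpen Ω) {x v : E3}
    (hx : x ∈ closure Ω) (hT : backwardExitTime Ω x v ≠ ⊤) :
    backwardExitPosition Ω x v ∈ frontier Ω := by
  obtain ⟨T, hTe⟩ : ∃ T : ℝ, backwardExitTime Ω x v = T :=
    ⟨_, (EReal.coe_toReal hT
      (ne_bot_of_le_ne_bot EReal.zero_ne_bot (backwardExitTime_nonneg Ω x v))).symm⟩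
  have hT0 : 0 ≤ T := by
    have := backwardExitTime_nonneg Ω x v
    rw [hTe] at this
    exact_mod_cast this
  have hub : ∀ s : ℝ, 0 ≤ s → (∀ τ : ℝ, 0 < τ → τ < s → x - τ • v ∈ Ω) → s ≤ T := by
    intro s hs h
    have : (s : EReal) ≤ backwardExitTime Ω x v := le_iSup₂_of_le s ⟨hs, h⟩ le_rfl
    rw [hTe] at this
    exact_mod_cast this
  have hin : ∀ τ : ℝ, 0 < τ → τ < T → x - τ • v ∈ Ω := by
    intro τ h0 h1
    have : (τ : EReal) < backwardExitTime Ω x v := by rw [hTe]; exact_mod_cast h1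
    obtain ⟨s, hs⟩ := lt_iSup_iff.1 this
    obtain ⟨hs', hlt⟩ := lt_iSup_iff.1 hs
    exact hs'.2 τ h0 (by exact_mod_cast hlt)
  have hc : Continuous fun τ : ℝ => x - τ • v := by fun_prop
  rw [backwardExitPosition, hTe, EReal.toReal_coe, hop.frontier_eq]
  refine ⟨?_, fun hmem => ?_⟩
  · rcases hT0.eq_or_lt with h | h
    -- With zero exit time the exit position is `x` itself.
    · simpa [← h] using hx
    · refine mem_closure_of_tendsto (hc.continuousWithinAt (s := Iio T) (x := T)).tendsto ?_
      filter_upwards [self_mem_nhdsWithin, Ioo_mem_nhdsLT h] with τ _ h2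
      exact hin τ h2.1 h2.2
  -- Were the exit point in the open set `Ω`, the trajectory would stay inside beyond `T`, against
  -- the supremum.
  · obtain ⟨ε, hε, hball⟩ := Metric.isOpen_iff.1 (hop.preimage hc) T hmem
    refine absurd (hub (T + ε) (by linarith) fun τ h0 h1 => ?_) (by linarith)
    rcases lt_or_ge τ T with h | h
    · exact hin τ h0 h
    · exact hball (by rw [Metric.mem_ball, Real.dist_eq, abs_of_nonneg] <;> linarith)

/-- Cycle positions lie on the boundary, unless the cycle time is already `-∞`. -/
theorem cycle_mem_frontier {Ω : Set E3} (hop : IsOpen Ω) (t : ℝ) {x v : E3} (hx : x ∈ closure Ω) :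
    ∀ (m : ℕ) (u : Fin m → E3),
      (cycle Ω t x v m u).1 = ⊥ ∨ (cycle Ω t x v m u).2 ∈ frontier Ω
  | 0, u => by
    by_cases hT : backwardExitTime Ω x v = ⊤
    · left; simp [cycle, hT]
    · exact Or.inr (backwardExitPosition_mem_frontier hop hx hT)
  | m + 1, u => by
    simp only [cycle]
    rcases cycle_mem_frontier hop t hx m (Fin.init u) with h | h
    · left; rw [h, EReal.bot_sub]
    · by_cases hT : backwardExitTime Ω (cycle Ω t x v m (Fin.init u)).2 (u (Fin.last m)) = ⊤
      · left; simp [hT]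
      · exact Or.inr (backwardExitPosition_mem_frontier hop (frontier_subset_closure h) hT)

theorem cycle_fst_le (Ω : Set E3) (t : ℝ) (x v : E3) :
    ∀ (m : ℕ) (u : Fin m → E3), (cycle Ω t x v m u).1 ≤ t
  | 0, _ => EReal.sub_le_of_le_add (le_add_of_nonneg_right (backwardExitTime_nonneg Ω x v))
  | m + 1, u => (EReal.sub_le_of_le_add (le_add_of_nonneg_right
      (backwardExitTime_nonneg Ω _ _))).trans (cycle_fst_le Ω t x v m (Fin.init u))

theorem cycleIntegral_mono (Ω : Set E3) (t : ℝ) (x v : E3) :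
    ∀ (m : ℕ) {G H : (Fin m → E3) → ℝ≥0∞}, (∀ u, G u ≤ H u) →
      cycleIntegral Ω t x v m G ≤ cycleIntegral Ω t x v m H
  | 0, _, _, h => h _
  | m + 1, _, _, h => cycleIntegral_mono Ω t x v m fun _ => lintegral_mono fun _ => h _

theorem cycleIntegral_const_mul (Ω : Set E3) (t : ℝ) (x v : E3) {a : ℝ≥0∞} (ha : a ≠ ⊤) :
    ∀ (m : ℕ) (G : (Fin m → E3) → ℝ≥0∞),
      cycleIntegral Ω t x v m (fun u => a * G u) = a * cycleIntegral Ω t x v m G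
  | 0, _ => rfl
  | m + 1, G => by
    simp only [cycleIntegral]
    rw [← cycleIntegral_const_mul Ω t x v ha m]
    congr 1
    ext u
    exact lintegral_const_mul' _ _ ha

/-- If the Laplace transform of the exit time is at most `q` at every boundary point, then the
exponential moment of the cycle time decays geometrically. -/
theorem cycleIntegral_exp_le {Ω : Set E3} (hop : IsOpen Ω) {q : ℝ≥0∞} (hq : q ≠ ⊤)
    (hΩ : ∀ y ∈ frontier Ω,
      ∫⁻ w, EReal.exp (-backwardExitTime Ω y w) ∂reflectionMeasure Ω y ≤ q)
    (t : ℝ) {x v : E3} (hx : x ∈ closure Ω) :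
    ∀ m : ℕ, cycleIntegral Ω t x v m (fun u => EReal.exp (cycle Ω t x v m u).1)
      ≤ q ^ m * ENNReal.ofReal (Real.exp t)
  | 0 => by
    -- The first flight has a prescribed velocity and yields no factor `q`; only `t_1 ≤ t` is used.
    simpa [cycleIntegral] using EReal.exp_monotone (cycle_fst_le Ω t x v 0 Fin.elim0)
  | m + 1 => by
    calc cycleIntegral Ω t x v (m + 1) (fun u => EReal.exp (cycle Ω t x v (m + 1) u).1)
        ≤ cycleIntegral Ω t x v m (fun u => q * EReal.exp (cycle Ω t x v m u).1) := by
          refine cycleIntegral_mono Ω t x v m fun u => ?_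
          -- Finiteness lets this factor leave the integral over the last velocity without any
          -- measurability.
          have htop : EReal.exp (cycle Ω t x v m u).1 ≠ ⊤ := fun h =>
            EReal.coe_ne_top t (top_le_iff.1 (EReal.exp_eq_top_iff.1 h ▸ cycle_fst_le Ω t x v m u))
          simp only [cycle, Fin.init_snoc, Fin.snoc_last, sub_eq_add_neg, EReal.exp_add]
          rw [lintegral_const_mul' _ _ htop, mul_comm q]
          -- If the cycle time is `-∞`, its exponential vanishes and the position is irrelevant.
          rcases cycle_mem_frontier hop t hx m u (v := v) with h | h
          · simp [h]
          · gcongr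
            exact hΩ _ h
      _ ≤ q ^ (m + 1) * ENNReal.ofReal (Real.exp t) := by
          rw [cycleIntegral_const_mul Ω t x v hq, pow_succ', mul_assoc]
          gcongr
          exact cycleIntegral_exp_le hop hq hΩ t hx m

theorem IsSmoothStrictlyConvexDomain.isOpen {Ω : Set E3} (hΩ : IsSmoothStrictlyConvexDomain Ω) :
    IsOpen Ω := by
  obtain ⟨-, -, ξ, hξ, rfl, -⟩ := hΩ
  exact isOpen_lt hξ.continuous continuous_const

/-- The Laplace transform of the exit time of the diffuse reflection is less than one, uniformly over
the boundary. -/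
theorem exists_lintegral_exp_neg_backwardExitTime_le {Ω : Set E3}
    (hΩ : IsSmoothStrictlyConvexDomain Ω) :
    ∃ q : ℝ, 0 < q ∧ q < 1 ∧ ∀ y ∈ frontier Ω,
      ∫⁻ w, EReal.exp (-backwardExitTime Ω y w) ∂reflectionMeasure Ω y ≤ ENNReal.ofReal q := by
  obtain ⟨c, hc, hbd⟩ := exists_boundary_bound hΩ
  obtain ⟨q, hq0, hq1, hq⟩ := exists_lintegral_exp_neg_le hc
  refine ⟨q, hq0, hq1, fun y hy => ?_⟩
  obtain ⟨ν, hν, hνb⟩ := hbd y hy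
  rw [hν.reflectionMeasure_eq]
  refine (lintegral_mono_ae ?_).trans (hq ν hν.1)
  filter_upwards [ae_halfMaxwellian_inner_pos ν] with w hw
  rw [← EReal.exp_coe, EReal.coe_neg]
  exact EReal.exp_monotone (EReal.neg_le_neg_iff.2 (hνb w hw))

end DiffuseCycles

/-! ### Conclusion: choice of the constants. -/

theorem mainTheorem6 (Ω : Set DiffuseCycles.E3)
    (hΩ : DiffuseCycles.IsSmoothStrictlyConvexDomain Ω) :
    ∃ C : ℝ, 0 < C ∧ ∃ A : ℝ, 0 < A ∧
      ∀ (t : ℝ) (k : ℕ), 0 ≤ t → 1 ≤ k → C * t ≤ (k : ℝ) →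
        (⨆ x ∈ closure Ω, ⨆ v : DiffuseCycles.E3,
          DiffuseCycles.cycleIntegral Ω t x v (k - 1)
            ({u : Fin (k - 1) → DiffuseCycles.E3 |
                0 ≤ (DiffuseCycles.cycle Ω t x v (k - 1) u).1}.indicator fun _ => 1))
          ≤ ENNReal.ofReal (A * Real.exp (-t)) := by
  obtain ⟨q, hq0, hq1, hq⟩ := DiffuseCycles.exists_lintegral_exp_neg_backwardExitTime_le hΩ
  have hlog : 0 < -Real.log q := neg_pos.2 (Real.log_neg hq0 hq1)
  -- The factor `2` gives `q ^ k ≤ exp (-2t)`, which beats the growth `exp t` and leaves `exp (-t)`;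
  -- `A = q⁻¹` compensates for having only `k - 1` factors.
  refine ⟨2 / -Real.log q, by positivity, q⁻¹, by positivity, fun t k _ hk hkt => ?_⟩
  refine iSup₂_le fun x hx => iSup_le fun v => ?_
  refine (DiffuseCycles.cycleIntegral_mono Ω t x v (k - 1)
    (H := fun u => EReal.exp (DiffuseCycles.cycle Ω t x v (k - 1) u).1) fun u => ?_).trans
    ((DiffuseCycles.cycleIntegral_exp_le hΩ.isOpen ENNReal.ofReal_ne_top hq t hx (k - 1)).trans ?_)
  · exact indicator_le (fun u hu => EReal.one_le_exp_iff.2 hu) u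
  · rw [← ENNReal.ofReal_pow hq0.le, ← ENNReal.ofReal_mul (by positivity)]
    refine ENNReal.ofReal_le_ofReal ?_
    have hpow : q ^ (k - 1) = q⁻¹ * Real.exp (k * Real.log q) := by
      obtain ⟨m, rfl⟩ : ∃ m, k = m + 1 := ⟨k - 1, by omega⟩
      rw [Real.exp_nat_mul, Real.exp_log hq0, Nat.add_sub_cancel, pow_succ]
      field_simp
    rw [div_mul_eq_mul_div, div_le_iff₀ hlog] at hkt
    rw [hpow, mul_assoc, ← Real.exp_add]
    gcongr
    linarith
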